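/- Let $n\ge 1$ and $m\ge 0$ be integers. For a set $Q\subseteq\mathbb Z$ let $G_{n,m}(Q)$ be the simple graph whose vertices are all $v=(v_0,\dots,v_{m+1})\in\mathbb Z_n\times Q^m\times\mathbb Z_n$ with $\sum_{i=0}^{m+1}v_i\equiv 0\pmod n$, where two distinct vertices $u,v$ are adjacent if there is $0\le i\le m$ such that $u_j=v_j$ for all $j\notin\{i,i+1\}$ and either $u_i=v_i+1$, $u_{i+1}=v_{i+1}-1$, or $u_i=v_i-1$, $u_{i+1}=v_{i+1}+1$ (the entries $0$ and $m+1$ are computed in $\mathbb Z_n$, the others in $\mathbb Z$). The Yoke graph is $Y_{n,m}=G_{n,m}(\{0,1\})$ and the dYoke graph is $Z_{n,m}=G_{n,m}(\{-1,0,1\})$; $0$ denotes the all-zero vertex, and $\mathrm{ecc}_G(v)$ is the maximal distance in $G$ from $v$ to a vertex of $G$. Theorem. For all $n\ge 1$ and $m\ge 0$, $\mathrm{ecc}_{Z_{n,m}}(0)=\mathrm{ecc}_{Y_{n,m}}(0)$, and this common value is given as follows. 1. If $n=1$, then $\mathrm{ecc}_{Z_{n,m}}(0)=\binom{\lceil m/2\rceil+1}{2}+\binom{\lfloor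 m/2\rfloor+1}{2}$. 2. If $0\le m\le n$, then $\mathrm{ecc}_{Z_{n,m}}(0)=\left\lfloor\frac{n(m+1)}{2}\right\rfloor$. 3. If $2\le n\le m$, let $d_0=\binom{\lfloor\frac{m+n}{2}\rfloor+1}{2}+\binom{\lceil\frac{m-n}{2}\rceil+1}{2}$. Then (a) if $2\mid(m-n)$ or $n\le\lceil\frac{m+1}{2}\rceil$, then $\mathrm{ecc}_{Z_{n,m}}(0)=d_0$; (b) otherwise, $\mathrm{ecc}_{Z_{n,m}}(0)=d_0+n-\lceil\frac{m+1}{2}\rceil$. -/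

import Mathlib

/-- The vertices of a yoke-type graph whose inner entries are taken from `Q`: sequences
`(v₀, …, v_{m+1})` in `ℤ_n × Q^m × ℤ_n` whose sum is divisible by `n`. The two buckets `v₀` and
`v_{m+1}` are elements of `ℤ_n`, identified with their smallest non-negative representatives. -/
@[ext]
structure YokeSeq (Q : Set ℤ) (n m : ℕ) where
  entry : Fin (m + 2) → ℤ
  left_bucket : 0 ≤ entry 0 ∧ entry 0 < n
  right_bucket : 0 ≤ entry (Fin.last (m + 1)) ∧ entry (Fin.last (m + 1)) < n
  inner : ∀ j, j ≠ 0 → j ≠ Fin.last (m + 1) → entry j ∈ Q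
  sum_dvd : (n : ℤ) ∣ ∑ j, entry j

/-- Equality of two values at position `j`: in `ℤ_n` if `j` is a bucket, in `ℤ` otherwise. -/
def YokeEntryEq (n m : ℕ) (j : Fin (m + 2)) (a b : ℤ) : Prop :=
  if j = 0 ∨ j = Fin.last (m + 1) then a ≡ b [ZMOD n] else a = b

/-- `u` is obtained from `v` by shifting a unit from entry `i + 1` to the left. -/
def YokeSeq.IsLeftShift {Q : Set ℤ} {n m : ℕ} (i : Fin (m + 1)) (u v : YokeSeq Q n m) : Prop :=
  YokeEntryEq n m i.castSucc (u.entry i.castSucc) (v.entry i.castSucc + 1) ∧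
    YokeEntryEq n m i.succ (u.entry i.succ) (v.entry i.succ - 1)

/-- `u` is obtained from `v` by shifting a unit from entry `i` to the right. -/
def YokeSeq.IsRightShift {Q : Set ℤ} {n m : ℕ} (i : Fin (m + 1)) (u v : YokeSeq Q n m) : Prop :=
  YokeEntryEq n m i.castSucc (u.entry i.castSucc) (v.entry i.castSucc - 1) ∧
    YokeEntryEq n m i.succ (u.entry i.succ) (v.entry i.succ + 1)

theorem YokeEntryEq.symm_add {n m : ℕ} {j : Fin (m + 2)} {a b : ℤ}
    (h : YokeEntryEq n m j a (b + 1)) : YokeEntryEq n m j b (a - 1) := by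
  unfold YokeEntryEq at *
  split_ifs at * with hj
  · have := (h.sub_right 1).symm
    rwa [add_sub_cancel_right] at this
  · omega

theorem YokeEntryEq.symm_sub {n m : ℕ} {j : Fin (m + 2)} {a b : ℤ}
    (h : YokeEntryEq n m j a (b - 1)) : YokeEntryEq n m j b (a + 1) := by
  unfold YokeEntryEq at *
  split_ifs at * with hj
  · have := (h.add_right 1).symm
    rwa [sub_add_cancel] at this
  · omega

/-- The graph on `YokeSeq Q n m` in which two distinct vertices are adjacent if one is obtained
from the other by a unit shift between two consecutive entries. (Distinctness only matters for
`n = 1`, `m = 0`, where it excludes a loop at the single vertex.) -/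
def yokeTypeGraph (Q : Set ℤ) (n m : ℕ) : SimpleGraph (YokeSeq Q n m) where
  Adj u v := u ≠ v ∧ ∃ i : Fin (m + 1),
    (∀ j, j ≠ i.castSucc → j ≠ i.succ → u.entry j = v.entry j) ∧
      (u.IsLeftShift i v ∨ u.IsRightShift i v)
  symm := by
    constructor
    rintro u v ⟨hne, i, hj, h⟩
    refine ⟨hne.symm, i, fun j h1 h2 => (hj j h1 h2).symm, ?_⟩
    rcases h with h | h
    · exact Or.inr ⟨h.1.symm_add, h.2.symm_sub⟩
    · exact Or.inl ⟨h.1.symm_sub, h.2.symm_add⟩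
  loopless := ⟨fun _ h => h.1 rfl⟩

/-- The all-zero sequence. -/
def YokeSeq.zero {Q : Set ℤ} (hQ : (0 : ℤ) ∈ Q) {n : ℕ} (m : ℕ) (hn : 1 ≤ n) : YokeSeq Q n m where
  entry _ := 0
  left_bucket := ⟨le_rfl, by exact_mod_cast hn⟩
  right_bucket := ⟨le_rfl, by exact_mod_cast hn⟩
  inner _ _ _ := hQ
  sum_dvd := by simp

/-- The Yoke graph `Y_{n,m}`: inner entries in `{0, 1}`. -/
abbrev yokeGraph (n m : ℕ) : SimpleGraph (YokeSeq {0, 1} n m) := yokeTypeGraph {0, 1} n m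

/-- The dYoke graph `Z_{n,m}`: inner entries in `{-1, 0, 1}`. -/
abbrev dYokeGraph (n m : ℕ) : SimpleGraph (YokeSeq {-1, 0, 1} n m) := yokeTypeGraph {-1, 0, 1} n m

/-- The vertex `0` of `Y_{n,m}`. -/
def yokeZero {n : ℕ} (m : ℕ) (hn : 1 ≤ n) : YokeSeq {0, 1} n m := YokeSeq.zero (by simp) m hn

/-- The vertex `0` of `Z_{n,m}`. -/
def dYokeZero {n : ℕ} (m : ℕ) (hn : 1 ≤ n) : YokeSeq {-1, 0, 1} n m := YokeSeq.zero (by simp) m hn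

/-- `binom(⌊(m+n)/2⌋ + 1, 2) + binom(⌈(m-n)/2⌉ + 1, 2)`, used only for `n ≤ m`
(`⌈/⌉` is division rounded up). -/
def yokeD0 (n m : ℕ) : ℕ :=
  Nat.choose ((m + n) / 2 + 1) 2 + Nat.choose ((m - n) ⌈/⌉ 2 + 1) 2

/-! Pass to partial sums: a vertex becomes an integer path `h 0, …, h m` with steps in `Q`,
determined up to translation by multiples of `n`. A unit shift between entries `i` and `i + 1`
changes only `h i`, by one. Hence the distance to the zero vertex is the minimum over `k` of the
`ℓ¹`-distance `pathWeight m h (n * k)`: an edge changes a weight by at most one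
(`YokeSeq.exists_pathWeight_le_length`), and a nonconstant path can always be improved by one
(`exists_path_step_toward`).

The eccentricity is therefore the max-min recorded in `IsPathRadius`. Sorting a path preserves its
weights, which explains why `{0, 1}` and `{-1, 0, 1}` give the same value.

For the upper bound (`exists_two_mul_pathWeight_le`), either the central part of the sorted path
lies between two consecutive multiples of `n`, and their two weights are averaged, or it crosses a
multiple, and positions `i` and `m - i` are paired. For the lower bound, explicit paths are paired
in the same way, so that `h i + h (m - i)` is `n` or nearly so, hence far from every `2 * n * k`. -/

/-! ### Weights of integer paths and the upper bound -/

/-- The `ℓ¹`-distance of the sequence `h 0, …, h m` from the constant sequence `c`. -/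
def pathWeight (m : ℕ) (h : ℕ → ℤ) (c : ℤ) : ℤ := ∑ i ∈ Finset.range (m + 1), |h i - c|

theorem two_mul_pathWeight (m : ℕ) (h : ℕ → ℤ) (c : ℤ) :
    2 * pathWeight m h c = ∑ i ∈ Finset.range (m + 1), (|h i - c| + |h (m - i) - c|) := by
  have := Finset.sum_range_reflect (fun i => |h i - c|) (m + 1)
  rw [Finset.sum_add_distrib]
  simp only [Nat.add_sub_cancel] at this
  rw [this, pathWeight]; ring

/-- Evaluates the sums produced by pairing `i` with `m - i`. Induction on `b` peels off the two
extreme terms; the rest is the previous sum shifted by one index. -/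
theorem sum_max_abs_sub (b c : ℕ) :
    ∑ i ∈ Finset.range (2 * b + c + 1), max |((2 * b + c : ℕ) : ℤ) - 2 * (i : ℤ)| c =
      (2 * b + c + 1) * c + 2 * b * (b + 1) := by
  induction b with
  | zero =>
    rw [Finset.sum_congr rfl (g := fun _ => (c : ℤ))]
    · simp
    · intro i hi
      rw [Finset.mem_range] at hi
      apply max_eq_right
      rw [abs_le]; push_cast; constructor <;> omega
  | succ b ih =>
    rw [show 2 * (b + 1) + c + 1 = (2 * b + c + 1) + 1 + 1 by ring, Finset.sum_range_succ,
      Finset.sum_range_succ', Finset.sum_congr rfl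
        (g := fun i : ℕ => max |((2 * b + c : ℕ) : ℤ) - 2 * (i : ℤ)| c), ih]
    · rw [max_eq_left, max_eq_left, abs_of_nonneg, abs_of_nonpos]
      · push_cast; ring
      · push_cast; omega
      · push_cast; omega
      · rw [abs_of_nonpos] <;> push_cast <;> omega
      · rw [abs_of_nonneg] <;> push_cast <;> omega
    · intro i _
      congr 2
      push_cast; ring

theorem abs_sub_le_of_step {m : ℕ} {h : ℕ → ℤ} (hh : ∀ i < m, |h (i + 1) - h i| ≤ 1) {i j : ℕ}
    (hij : i ≤ j) (hj : j ≤ m) : |h j - h i| ≤ (j : ℤ) - i := by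
  induction j, hij using Nat.le_induction with
  | base => simp
  | succ j hij ih =>
    have h1 := ih (by omega)
    have h2 := hh j (by omega)
    rw [abs_le] at *
    push_cast
    constructor <;> linarith

/-- Sorting a sequence with steps at most one gives a sequence with steps zero and one. -/
theorem exists_monotone_rearrangement {m : ℕ} {h : ℕ → ℤ}
    (hh : ∀ i < m, |h (i + 1) - h i| ≤ 1) :
    ∃ g : ℕ → ℤ, (∀ i < m, g i ≤ g (i + 1) ∧ g (i + 1) ≤ g i + 1) ∧
      ∀ c, pathWeight m g c = pathWeight m h c := by
  let f : Fin (m + 1) → ℤ := fun i => h i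
  let s := Tuple.sort f
  have hs : Monotone (f ∘ s) := Tuple.monotone_sort f
  refine ⟨fun i => if hi : i < m + 1 then f (s ⟨i, hi⟩) else 0, ?_, ?_⟩
  · intro i hi
    have h1 : i < m + 1 := by omega
    have h2 : i + 1 < m + 1 := by omega
    simp only [h1, h2, dif_pos]
    refine ⟨hs (Fin.mk_le_mk.2 (Nat.le_succ i)), ?_⟩
    by_contra! hlt
    have gap : ∀ j < m + 1, h j ≤ f (s ⟨i, h1⟩) ∨ f (s ⟨i + 1, h2⟩) ≤ h j := by
      intro j hj
      obtain ⟨t, ht⟩ := s.surjective ⟨j, hj⟩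
      have e : (f ∘ s) t = h j := by simp [f, ht]
      rcases Nat.lt_or_ge i t.1 with hit | hit
      · right; rw [← e]; exact hs (Fin.mk_le_of_le_val hit)
      · left; rw [← e]; exact hs (Fin.le_def.2 hit)
    -- Discrete intermediate value argument: unit steps cannot jump a gap of length two, so the
    -- whole path stays on one side of it, although both ends of the gap are attained.
    have side : ∀ j < m + 1, (h j ≤ f (s ⟨i, h1⟩) ↔ h 0 ≤ f (s ⟨i, h1⟩)) := by
      intro j
      induction j with
      | zero => simp
      | succ j ih =>
        intro hj
        rw [← ih (by omega)]
        have a := hh j (by omega)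
        rw [abs_le] at a
        have b := gap j (by omega)
        have c := gap (j + 1) hj
        constructor <;> intro <;> omega
    have e1 : h (s ⟨i, h1⟩) ≤ f (s ⟨i, h1⟩) := le_rfl
    have e2 : f (s ⟨i + 1, h2⟩) ≤ h (s ⟨i + 1, h2⟩) := le_rfl
    rw [side _ (s ⟨i, h1⟩).2, ← side _ (s ⟨i + 1, h2⟩).2] at e1
    omega
  · intro c
    unfold pathWeight
    rw [Finset.sum_range, Finset.sum_range]
    simp only [Fin.is_lt, dif_pos, Fin.eta]
    exact Equiv.sum_comp s (fun i => |f i - c|)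

/-- If `h` passes from below `c` to above `c` between the symmetric positions `b` and `m - b`,
then its distance from `c` is small. -/
theorem two_mul_pathWeight_le_of_crossing {m b : ℕ} {h : ℕ → ℤ}
    (hh : ∀ i < m, |h (i + 1) - h i| ≤ 1) (hb : 2 * b ≤ m) {c : ℤ} (h0 : h b ≤ c - 1)
    (h1 : c + 1 ≤ h (m - b)) :
    2 * pathWeight m h c ≤
      ∑ i ∈ Finset.range (m + 1), max |(m : ℤ) - 2 * (i : ℤ)| ((m : ℤ) - 2 * b - 2) := by
  rw [two_mul_pathWeight]
  have lip : ∀ i ≤ m, ∀ j ≤ m, |h i - h j| ≤ |(i : ℤ) - j| := by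
    intro i hi j hj
    rcases le_total i j with hij | hij
    · have := abs_sub_le_of_step hh hij hj
      rwa [abs_sub_comm, abs_sub_comm (i : ℤ), abs_of_nonneg (by omega : 0 ≤ (j : ℤ) - i)]
    · have := abs_sub_le_of_step hh hij hi
      rwa [abs_of_nonneg (by omega : 0 ≤ (i : ℤ) - j)]
  refine Finset.sum_le_sum fun i hi => ?_
  rw [Finset.mem_range] at hi
  have l1 := lip i (by omega) (m - i) (by omega)
  have l2 := lip i (by omega) b (by omega)
  have l3 := lip i (by omega) (m - b) (by omega)
  have l4 := lip (m - i) (by omega) b (by omega)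
  have l5 := lip (m - i) (by omega) (m - b) (by omega)
  push_cast [Nat.sub_le, show i ≤ m by omega, show b ≤ m by omega] at *
  generalize h i = x at *
  generalize h (m - i) = y at *
  generalize h b = z at *
  generalize h (m - b) = w at *
  -- If `x` and `y` lie on opposite sides of `c`, their distances add up to `|x - y|`. On the same
  -- side, compare both with whichever of `z`, `w` lies across `c`: each comparison saves one, which
  -- gives the `-2`.
  rw [le_max_iff]
  rw [abs_le] at l1 l2 l3 l4 l5
  rcases abs_cases (x - c) with a1 | a1 <;> rcases abs_cases (y - c) with a2 | a2 <;>
  rcases abs_cases ((m : ℤ) - 2 * i) with a3 | a3 <;>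
  rcases abs_cases ((i : ℤ) - b) with a4 | a4 <;> grind

/-- The parameter `b` is the number of positions discarded at each end of the sorted path before
asking whether it crosses a multiple of `n`. -/
theorem exists_two_mul_pathWeight_le {n m b : ℕ} (hn : 1 ≤ n) (hb : 2 * b ≤ m) {h : ℕ → ℤ}
    (hh : ∀ i < m, |h (i + 1) - h i| ≤ 1) :
    ∃ k : ℤ, 2 * pathWeight m h (n * k) ≤ n * (m + 1) + 2 * b * (b + 1) ∨
      2 * pathWeight m h (n * k) ≤
        ∑ i ∈ Finset.range (m + 1), max |(m : ℤ) - 2 * (i : ℤ)| ((m : ℤ) - 2 * b - 2) := by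
  obtain ⟨g, hg, hgw⟩ := exists_monotone_rearrangement hh
  simp only [← hgw]
  have hg1 : ∀ i < m, |g (i + 1) - g i| ≤ 1 := by
    intro i hi
    have := hg i hi
    rw [abs_le]; omega
  have mono : ∀ i j, i ≤ j → j ≤ m → g i ≤ g j := by
    intro i j hij
    induction j, hij using Nat.le_induction with
    | base => simp
    | succ j hij ih => intro hj; exact (ih (by omega)).trans (hg j (by omega)).1
  have hn0 : (0 : ℤ) < n := by exact_mod_cast hn
  set k := g b / (n : ℤ) with hk
  have k1 : (n : ℤ) * k ≤ g b := Int.mul_ediv_self_le hn0.ne'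
  have k2 : g b < n * k + n := by
    have := Int.lt_mul_ediv_self_add (x := g b) hn0
    exact this
  -- If the central positions lie in `[n * k, n * (k + 1)]`, each contributes exactly `n` to the sum
  -- of the two weights, and a position at distance `d` outside the centre at most `n + 2 * d`. The
  -- smaller weight is at most the average.
  by_cases hc : g (m - b) ≤ n * (k + 1)
  · have key : pathWeight m g (n * k) + pathWeight m g (n * (k + 1)) ≤
        n * (m + 1) + 2 * b * (b + 1) := by
      have e := sum_max_abs_sub b (m - 2 * b)
      rw [show 2 * b + (m - 2 * b) = m by omega] at e
      have e' : n * (m + 1) + 2 * b * (b + 1) = ∑ i ∈ Finset.range (m + 1),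
          ((n : ℤ) + (max |(m : ℤ) - 2 * (i : ℤ)| ((m - 2 * b : ℕ) : ℤ) - (m - 2 * b : ℕ))) := by
        rw [Finset.sum_add_distrib, Finset.sum_sub_distrib, e]
        simp only [Finset.sum_const, Finset.card_range, nsmul_eq_mul]
        push_cast [hb]; ring
      rw [e', pathWeight, pathWeight, ← Finset.sum_add_distrib]
      refine Finset.sum_le_sum fun i hi => ?_
      rw [Finset.mem_range] at hi
      have l0 : (m : ℤ) - 2 * i ≤ |(m : ℤ) - 2 * i| := le_abs_self _
      have l0' : -((m : ℤ) - 2 * i) ≤ |(m : ℤ) - 2 * i| := neg_le_abs _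
      have m1 := le_max_left |(m : ℤ) - 2 * (i : ℤ)| ((m - 2 * b : ℕ) : ℤ)
      have m2 := le_max_right |(m : ℤ) - 2 * (i : ℤ)| ((m - 2 * b : ℕ) : ℤ)
      rw [mul_add, mul_one] at *
      rcases le_total b i with hbi | hbi
      · have q1 := mono b i hbi (by omega)
        rw [abs_of_nonneg (by linarith : 0 ≤ g i - n * k)]
        rcases le_total i (m - b) with hbj | hbj
        · have q2 := mono i (m - b) hbj (by omega)
          rw [abs_of_nonpos (by linarith : g i - (n * k + n) ≤ 0)]
          linarith
        · have q2 := abs_le.1 (abs_sub_le_of_step hg1 hbj (by omega))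
          rcases abs_cases (g i - (n * k + n)) with a | a <;> omega
      · have q1 := mono i b hbi (by omega)
        have q2 := abs_le.1 (abs_sub_le_of_step hg1 hbi (by omega))
        rw [abs_of_nonpos (by linarith : g i - (n * k + n) ≤ 0)]
        rcases abs_cases (g i - n * k) with a | a <;> omega
    rcases le_total (pathWeight m g (n * k)) (pathWeight m g (n * (k + 1))) with q | q
    · exact ⟨k, Or.inl (by linarith)⟩
    · exact ⟨k + 1, Or.inl (by linarith)⟩
  · exact ⟨k + 1, Or.inr (two_mul_pathWeight_le_of_crossing hg1 hb (by rw [mul_add]; omega)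
      (by omega))⟩

/-! ### Extremal paths and the exact radius -/

/-- `B` is the largest distance of an admissible path from the constant paths at multiples of `n`:
it is an upper bound for all paths with steps in `{-1, 0, 1}` and is attained by one with steps
in `{0, 1}`. -/
structure IsPathRadius (n m B : ℕ) : Prop where
  le : ∀ h : ℕ → ℤ, (∀ i < m, |h (i + 1) - h i| ≤ 1) → ∃ k : ℤ, pathWeight m h (n * k) ≤ B
  ge : ∃ h : ℕ → ℤ, (∀ i < m, h (i + 1) - h i = 0 ∨ h (i + 1) - h i = 1) ∧
    ∀ k : ℤ, (B : ℤ) ≤ pathWeight m h (n * k)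

/-- The difference is an odd multiple of `n`. The lower bounds combine this with `|x - c| + |y - c|
≥ max |x - y| |x + y - 2 * c|` for paired values `x`, `y` with sum close to `n`. -/
theorem abs_sub_two_mul_mul_ge (n : ℕ) (k : ℤ) : (n : ℤ) ≤ |n - 2 * (n * k)| := by
  rcases le_or_gt k 0 with hk | hk
  · refine le_trans ?_ (le_abs_self _)
    nlinarith [Int.natCast_nonneg n]
  · refine le_trans ?_ (neg_le_abs _)
    nlinarith [Int.natCast_nonneg n]

theorem isPathRadius_of_le {n m : ℕ} (hn : 1 ≤ n) (hm : m ≤ n) :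
    IsPathRadius n m (n * (m + 1) / 2) where
  le h hh := by
    obtain ⟨k, hk⟩ := exists_two_mul_pathWeight_le (b := 0) hn (Nat.zero_le _) hh
    refine ⟨k, ?_⟩
    have : 2 * pathWeight m h (n * k) ≤ n * (m + 1) := by
      rcases hk with hk | hk
      · simpa using hk
      · refine hk.trans ((Finset.sum_le_card_nsmul _ _ (n : ℤ) ?_).trans ?_)
        · intro i hi
          rw [Finset.mem_range] at hi
          apply max_le
          · rw [abs_le]; constructor <;> omega
          · omega
        · simp [mul_comm]
    push_cast
    omega
  ge := by
    -- Stay as close to `n / 2` as possible. Paired values add up to `n`, except that an unpaired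
    -- middle position loses one when `n` is odd; the final rounding absorbs this.
    refine ⟨fun i => if i < m + 1 - (m + 1) / 2 then (n / 2 : ℕ) else ((n + 1) / 2 : ℕ), ?_, ?_⟩
    · intro i _
      dsimp only
      split_ifs <;> omega
    · intro k
      have key : ((n * (m + 1) : ℕ) : ℤ) - 1 ≤ 2 * pathWeight m
          (fun i => if i < m + 1 - (m + 1) / 2 then (n / 2 : ℕ) else ((n + 1) / 2 : ℕ))
            (n * k) := by
        have e : ((n * (m + 1) : ℕ) : ℤ) - 1 ≤ ∑ i ∈ Finset.range (m + 1),
            ((n : ℤ) - if m / 2 = i then 1 else 0) := by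
          rw [Finset.sum_sub_distrib, Finset.sum_ite_eq, if_pos (by simp; omega)]
          simp [mul_comm]
        rw [two_mul_pathWeight]
        refine e.trans (Finset.sum_le_sum fun i hi => ?_)
        rw [Finset.mem_range] at hi
        have a := abs_sub_two_mul_mul_ge n k
        rcases abs_cases ((n : ℤ) - 2 * (n * k)) with a' | a' <;>
        generalize (n : ℤ) * k = c at * <;> split_ifs <;> grind
      omega

/-- With `m = n + 2 * b` the averaging bound is exactly `2 * B`, and the crossing bound is no
larger. The path `i - b` is extremal: its paired values sum to `n`. -/
theorem isPathRadius_of_even {n b B : ℕ} (hn : 1 ≤ n)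
    (hB : 2 * B = n * (n + 2 * b + 1) + 2 * b * (b + 1)) : IsPathRadius n (n + 2 * b) B where
  le h hh := by
    obtain ⟨k, hk⟩ := exists_two_mul_pathWeight_le (b := b) hn (by omega) hh
    refine ⟨k, ?_⟩
    have hB' : (2 * B : ℤ) = n * (n + 2 * b + 1) + 2 * b * (b + 1) := by exact_mod_cast hB
    have : 2 * pathWeight (n + 2 * b) h (n * k) ≤ 2 * B := by
      rw [hB']
      rcases hk with hk | hk
      · exact_mod_cast hk
      · have e := sum_max_abs_sub b n
        rw [show 2 * b + n = n + 2 * b by ring] at e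
        refine hk.trans ((Finset.sum_le_sum fun i _ => max_le_max_left _ ?_).trans (e.le.trans ?_))
        · push_cast; omega
        · apply le_of_eq; ring
    omega
  ge := by
    refine ⟨fun i => (i : ℤ) - b, fun i _ => Or.inr (by push_cast; ring), fun k => ?_⟩
    have hB' : (2 * B : ℤ) = n * (n + 2 * b + 1) + 2 * b * (b + 1) := by exact_mod_cast hB
    have e := sum_max_abs_sub b n
    rw [show 2 * b + n = n + 2 * b by ring] at e
    have : (2 * B : ℤ) ≤ 2 * pathWeight (n + 2 * b) (fun i => (i : ℤ) - b) (n * k) := by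
      rw [hB', two_mul_pathWeight, show (n * (n + 2 * b + 1) + 2 * b * (b + 1) : ℤ) =
        (2 * b + n + 1) * n + 2 * b * (b + 1) by ring, ← e]
      refine Finset.sum_le_sum fun i hi => ?_
      rw [Finset.mem_range] at hi
      have a := abs_sub_two_mul_mul_ge n k
      push_cast [show i ≤ n + 2 * b by omega]
      generalize (n : ℤ) * k = c at *
      grind
    omega

/-- Here `2 * A` is the crossing bound, and the left side of `hB` is the averaging bound. The slack
of one is free because weights are integers. -/
theorem exists_pathWeight_le_of_odd {n b A B : ℕ} (hn : 1 ≤ n)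
    (hA : 2 * A = n * (n + 1 + 2 * b) + 2 * (b + 1) ^ 2) (hAB : A ≤ B)
    (hB : n * (n + 2 * b + 2) + 2 * b * (b + 1) ≤ 2 * B + 1) {h : ℕ → ℤ}
    (hh : ∀ i < n + 1 + 2 * b, |h (i + 1) - h i| ≤ 1) :
    ∃ k : ℤ, pathWeight (n + 1 + 2 * b) h (n * k) ≤ B := by
  obtain ⟨k, hk⟩ := exists_two_mul_pathWeight_le (b := b) hn (by omega) hh
  refine ⟨k, ?_⟩
  rcases hk with hk | hk
  · have hB' : (n * (n + 2 * b + 2) + 2 * b * (b + 1) : ℤ) ≤ 2 * B + 1 := by exact_mod_cast hB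
    push_cast at hk
    have : (n * (n + 1 + 2 * b + 1) : ℤ) = n * (n + 2 * b + 2) := by ring
    omega
  · have hA' : (2 * A : ℤ) = n * (n + 1 + 2 * b) + 2 * (b + 1) ^ 2 := by exact_mod_cast hA
    have e := sum_max_abs_sub (b + 1) (n - 1)
    rw [show 2 * (b + 1) + (n - 1) = n + 1 + 2 * b by omega] at e
    have e2 : ((n + 1 + 2 * b : ℕ) : ℤ) - 2 * b - 2 = (n - 1 : ℕ) := by
      push_cast [hn]; ring
    rw [e2, e] at hk
    push_cast [hn] at hk
    have : 2 * pathWeight (n + 1 + 2 * b) h (n * k) ≤ 2 * A := by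
      rw [hA']; refine hk.trans (le_of_eq ?_); ring
    omega

/-- The averaging bound exceeds the crossing bound by `n - (2 * b + 2)`, here at most one, so the
crossing bound decides. For the path `i - (b + 1)` paired values sum to `n - 1`. -/
theorem isPathRadius_of_odd_of_le {n b A : ℕ} (hn : 1 ≤ n)
    (hA : 2 * A = n * (n + 1 + 2 * b) + 2 * (b + 1) ^ 2) (hnb : n ≤ 2 * b + 3) :
    IsPathRadius n (n + 1 + 2 * b) A where
  le h hh := exists_pathWeight_le_of_odd hn hA le_rfl (by rw [hA]; nlinarith) hh
  ge := by
    refine ⟨fun i => (i : ℤ) - (b + 1), fun i _ => Or.inr (by push_cast; ring), fun k => ?_⟩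
    have hA' : (2 * A : ℤ) = n * (n + 1 + 2 * b) + 2 * (b + 1) ^ 2 := by exact_mod_cast hA
    have e := sum_max_abs_sub (b + 1) (n - 1)
    rw [show 2 * (b + 1) + (n - 1) = n + 1 + 2 * b by omega] at e
    have : (2 * A : ℤ) ≤ 2 * pathWeight (n + 1 + 2 * b) (fun i => (i : ℤ) - (b + 1)) (n * k) := by
      rw [hA', two_mul_pathWeight, show (n * (n + 1 + 2 * b) + 2 * (b + 1) ^ 2 : ℤ) =
        (2 * (b + 1 : ℕ) + (n - 1 : ℕ) + 1) * (n - 1 : ℕ) + 2 * (b + 1 : ℕ) * ((b + 1 : ℕ) + 1) by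
          push_cast [hn]; ring, ← e]
      refine Finset.sum_le_sum fun i hi => ?_
      rw [Finset.mem_range] at hi
      have a := abs_sub_two_mul_mul_ge n k
      push_cast [show i ≤ n + 1 + 2 * b by omega, hn]
      generalize (n : ℤ) * k = c at *
      grind
    omega

theorem isPathRadius_of_odd_of_ge {n b B : ℕ} (hn : 1 ≤ n)
    (hB : B = (n * (n + 2 * b + 2) + 2 * b * (b + 1)) / 2) (hnb : 2 * b + 2 ≤ n) :
    IsPathRadius n (n + 1 + 2 * b) B where
  le h hh := by
    have hp : Even (n * (n + 1 + 2 * b)) := by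
      rcases Nat.even_or_odd n with hn | hn
      · exact hn.mul_right _
      · refine Even.mul_left ?_ _
        obtain ⟨t, rfl⟩ := hn
        exact ⟨t + 1 + b, by ring⟩
    obtain ⟨t, ht⟩ := hp
    have hA : 2 * (t + (b + 1) ^ 2) = n * (n + 1 + 2 * b) + 2 * (b + 1) ^ 2 := by rw [ht]; ring
    refine exists_pathWeight_le_of_odd hn hA ?_ (by omega) hh
    rw [hB, Nat.le_div_iff_mul_le (by norm_num), mul_comm, hA]
    nlinarith
  ge := by
    -- One flat step in the middle makes paired values sum to `n`, at the price of reducing their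
    -- difference by one. For odd `n` the middle position is paired with itself and gives only `n -
    -- 1`, hence the extra correction in `e'`.
    refine ⟨fun i => if i ≤ b + n / 2 then (i : ℤ) - b else (i : ℤ) - b - 1, ?_, fun k => ?_⟩
    · intro i _
      dsimp only
      push_cast
      split_ifs <;> omega
    have e := sum_max_abs_sub b (n + 1)
    rw [show 2 * b + (n + 1) = n + 1 + 2 * b by ring] at e
    have key : ((n * (n + 2 * b + 2) + 2 * b * (b + 1) : ℕ) : ℤ) - 1 ≤
        2 * pathWeight (n + 1 + 2 * b)
          (fun i => if i ≤ b + n / 2 then (i : ℤ) - b else (i : ℤ) - b - 1) (n * k) := by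
      have e' : ((n * (n + 2 * b + 2) + 2 * b * (b + 1) : ℕ) : ℤ) - 1 =
          ∑ i ∈ Finset.range (n + 1 + 2 * b + 1),
            (max |((n + 1 + 2 * b : ℕ) : ℤ) - 2 * (i : ℤ)| ((n + 1 : ℕ) : ℤ) - 1 -
              if (n + 1 + 2 * b) / 2 = i then 1 else 0) := by
        rw [Finset.sum_sub_distrib, Finset.sum_ite_eq, if_pos (by simp; omega),
          Finset.sum_sub_distrib, e]
        simp only [Finset.sum_const, Finset.card_range, nsmul_eq_mul]
        push_cast; ring
      rw [e', two_mul_pathWeight]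
      refine Finset.sum_le_sum fun i hi => ?_
      rw [Finset.mem_range] at hi
      have a := abs_sub_two_mul_mul_ge n k
      push_cast [show i ≤ n + 1 + 2 * b by omega]
      generalize (n : ℤ) * k = c at *
      grind
    omega

/-! ### Vertices as paths of partial sums -/

/-- The vertex whose partial sums are
`h 0, …, h m`, up to translation by multiples of `n`. -/
def YokeSeq.ofPath {Q : Set ℤ} {n m : ℕ} (hn : 1 ≤ n) (h : ℕ → ℤ)
    (hh : ∀ i < m, h (i + 1) - h i ∈ Q) : YokeSeq Q n m where
  entry j := if j = 0 then h 0 % n else if j = Fin.last (m + 1) then (-h m) % n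
    else h j - h (j - 1)
  left_bucket := by
    have : (0 : ℤ) < n := by exact_mod_cast hn
    simpa using ⟨Int.emod_nonneg _ this.ne', Int.emod_lt_of_pos _ this⟩
  right_bucket := by
    have : (0 : ℤ) < n := by exact_mod_cast hn
    simpa using ⟨Int.emod_nonneg _ this.ne', Int.emod_lt_of_pos _ this⟩
  inner j h0 h1 := by
    rw [if_neg h0, if_neg h1]
    have a : (j : ℕ) ≠ 0 := fun e => h0 (Fin.ext e)
    have b : (j : ℕ) ≠ m + 1 := fun e => h1 (Fin.ext e)
    have := hh (j - 1) (by omega)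
    rwa [show (j : ℕ) - 1 + 1 = j by omega] at this
  sum_dvd := by
    rw [Fin.sum_univ_succ, Fin.sum_univ_castSucc]
    have e : ∀ i : Fin m, (i.castSucc.succ : Fin (m + 2)) ≠ Fin.last (m + 1) := by
      intro i hi
      have := congrArg Fin.val hi
      simp at this; omega
    simp only [Fin.succ_ne_zero, if_true, if_false, e, Fin.succ_last, Nat.succ_eq_add_one,
      Fin.last_eq_zero_iff, Nat.add_eq_zero_iff, one_ne_zero, and_false]
    have t : ∑ i : Fin m, (h (i.castSucc.succ : Fin (m + 2)) -
        h ((i.castSucc.succ : Fin (m + 2)) - 1 : ℕ)) = h m - h 0 := by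
      rw [← Finset.sum_range_sub, Finset.sum_range]
      rfl
    rw [t]
    have a := Int.emod_add_mul_ediv (h 0) n
    have b := Int.emod_add_mul_ediv (-h m) n
    exact ⟨-(h 0 / n) - (-h m) / n, by linear_combination a + b⟩

section

variable {Q : Set ℤ} {n m : ℕ}

theorem YokeSeq.ofPath_entry_zero (hn : 1 ≤ n) (h : ℕ → ℤ) (hh : ∀ i < m, h (i + 1) - h i ∈ Q) :
    (YokeSeq.ofPath hn h hh).entry 0 = h 0 % n := rfl

theorem YokeSeq.ofPath_entry_last (hn : 1 ≤ n) (h : ℕ → ℤ) (hh : ∀ i < m, h (i + 1) - h i ∈ Q) :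
    (YokeSeq.ofPath hn h hh).entry (Fin.last (m + 1)) = (-h m) % n := by
  simp [YokeSeq.ofPath]

theorem YokeSeq.ofPath_entry_inner (hn : 1 ≤ n) (h : ℕ → ℤ) (hh : ∀ i < m, h (i + 1) - h i ∈ Q)
    {j : Fin (m + 2)} (h0 : j ≠ 0) (h1 : j ≠ Fin.last (m + 1)) :
    (YokeSeq.ofPath hn h hh).entry j = h j - h (j - 1) := by
  simp [YokeSeq.ofPath, h0, h1]

/-- The partial sums of a vertex. -/
def YokeSeq.path (v : YokeSeq Q n m) (i : ℕ) : ℤ :=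
  ∑ j ∈ Finset.range (i + 1), if hj : j < m + 2 then v.entry ⟨j, hj⟩ else 0

theorem YokeSeq.path_zero (v : YokeSeq Q n m) : v.path 0 = v.entry 0 := by
  simp [YokeSeq.path]

theorem YokeSeq.path_succ (v : YokeSeq Q n m) {i : ℕ} (hi : i < m + 1) :
    v.path (i + 1) = v.path i + v.entry ⟨i + 1, by omega⟩ := by
  rw [YokeSeq.path, Finset.sum_range_succ, dif_pos (by omega)]
  rfl

theorem YokeSeq.path_step_mem (v : YokeSeq Q n m) : ∀ i < m, v.path (i + 1) - v.path i ∈ Q := by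
  intro i hi
  rw [v.path_succ (by omega), add_sub_cancel_left]
  refine v.inner _ ?_ ?_ <;> intro h <;> have := congrArg Fin.val h <;> simp at this
  omega

theorem YokeSeq.dvd_path_add_last (v : YokeSeq Q n m) :
    (n : ℤ) ∣ v.path m + v.entry (Fin.last (m + 1)) := by
  have e : v.path m + v.entry (Fin.last (m + 1)) = ∑ j, v.entry j := by
    have := v.path_succ (i := m) (by omega)
    have e2 : v.path (m + 1) = ∑ j, v.entry j := by
      rw [YokeSeq.path, Finset.sum_range]
      exact Finset.sum_congr rfl fun i _ => dif_pos i.2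
    rw [← e2, this]; rfl
  rw [e]; exact v.sum_dvd

theorem YokeSeq.ofPath_path (hn : 1 ≤ n) (v : YokeSeq Q n m) :
    YokeSeq.ofPath hn v.path v.path_step_mem = v := by
  ext j
  rcases eq_or_ne j 0 with rfl | h0
  · rw [ofPath_entry_zero, path_zero]
    exact Int.emod_eq_of_lt v.left_bucket.1 v.left_bucket.2
  rcases eq_or_ne j (Fin.last (m + 1)) with rfl | h1
  · rw [ofPath_entry_last, ← Int.emod_eq_of_lt v.right_bucket.1 v.right_bucket.2]
    have := v.dvd_path_add_last
    refine Int.ModEq.symm (Int.modEq_iff_dvd.2 ?_)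
    rw [show -v.path m - v.entry (Fin.last (m + 1)) =
      -(v.path m + v.entry (Fin.last (m + 1))) by ring]
    exact this.neg_right
  · rw [ofPath_entry_inner _ _ _ h0 h1]
    obtain ⟨j, hj⟩ := j
    cases j with
    | zero => exact absurd rfl h0
    | succ j =>
      simp only [Nat.add_sub_cancel]
      rw [v.path_succ (by omega), add_sub_cancel_left]

/-! ### Edges as unit moves, and distances to the zero vertex -/

/-- Along an edge, the partial sums change by one in a single place, up to a common multiple
of `n`. -/
theorem YokeSeq.exists_path_of_adj {u v : YokeSeq Q n m} (huv : (yokeTypeGraph Q n m).Adj u v) :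
    ∃ (k : ℤ) (i : ℕ), ∀ j ≤ m, |v.path j - (u.path j + n * k)| ≤ if j = i then 1 else 0 := by
  obtain ⟨-, i, hj, hi⟩ := huv
  have inner : ∀ j : Fin (m + 2), (j : ℕ) ≠ 0 → (j : ℕ) ≠ m + 1 →
      ¬ (j = 0 ∨ j = Fin.last (m + 1)) := by
    rintro j h0 h1 (rfl | rfl) <;> simp at h0 h1
  have main : ∃ (k ε : ℤ), |ε| ≤ 1 ∧ ∀ j ≤ m, v.path j - (u.path j + n * k) =
      if j = i then ε else 0 := by
    have shift : ∃ ε : ℤ, |ε| ≤ 1 ∧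
        YokeEntryEq n m i.castSucc (u.entry i.castSucc) (v.entry i.castSucc - ε) ∧
        YokeEntryEq n m i.succ (u.entry i.succ) (v.entry i.succ + ε) := by
      rcases hi with hi | hi
      · exact ⟨-1, by simp, by simpa [sub_eq_add_neg] using hi.1, by
          simpa [sub_eq_add_neg] using hi.2⟩
      · exact ⟨1, by simp, hi.1, hi.2⟩
    obtain ⟨ε, hε, h1, h2⟩ := shift
    -- The multiple of `n` arises only when the shift involves the left bucket and wraps around in
    -- `ℤ_n`.
    have start : ∃ k : ℤ, v.path 0 - (u.path 0 + n * k) = if 0 = (i : ℕ) then ε else 0 := by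
      rw [path_zero, path_zero]
      split_ifs with h0
      · have : i.castSucc = 0 := Fin.ext h0.symm
        rw [this, YokeEntryEq, if_pos (Or.inl rfl)] at h1
        obtain ⟨k, hk⟩ := h1.dvd
        exact ⟨k, by linarith⟩
      · refine ⟨0, ?_⟩
        rw [hj 0 (fun e => h0 (congrArg Fin.val e)) (Fin.succ_ne_zero i).symm]
        ring
    obtain ⟨k, hk⟩ := start
    refine ⟨k, ε, hε, fun j => ?_⟩
    induction j with
    | zero => exact fun _ => hk
    | succ j ih =>
      intro hjm
      have ih := ih (by omega)
      rw [u.path_succ (by omega), v.path_succ (by omega)]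
      by_cases c1 : (i : ℕ) = j + 1
      · have e : (⟨j + 1, by omega⟩ : Fin (m + 2)) = i.castSucc := Fin.ext c1.symm
        rw [YokeEntryEq, if_neg (inner _ (by rw [Fin.val_castSucc]; omega)
          (by rw [Fin.val_castSucc]; omega))] at h1
        rw [if_pos c1.symm, e, h1]
        rw [if_neg (by omega)] at ih
        linarith
      by_cases c2 : (i : ℕ) = j
      · have e : (⟨j + 1, by omega⟩ : Fin (m + 2)) = i.succ := Fin.ext (by simp [c2])
        rw [YokeEntryEq, if_neg (inner _ (by simp) (by simp; omega))] at h2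
        rw [if_neg (by omega), e, h2]
        rw [if_pos c2.symm] at ih
        linarith
      · rw [hj ⟨j + 1, by omega⟩ (fun e => c1 (congrArg Fin.val e).symm)
          (fun e => c2 (by have := congrArg Fin.val e; simp at this; omega))]
        rw [if_neg (by omega)] at ih ⊢
        linarith
  obtain ⟨k, ε, hε, hm⟩ := main
  refine ⟨k, i, fun j hjm => ?_⟩
  rw [hm j hjm]
  split_ifs <;> simp [hε]

theorem YokeSeq.exists_pathWeight_le_length (hQ : (0 : ℤ) ∈ Q) (hn : 1 ≤ n) {v : YokeSeq Q n m}
    (p : (yokeTypeGraph Q n m).Walk v (YokeSeq.zero hQ m hn)) :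
    ∃ k : ℤ, pathWeight m v.path (n * k) ≤ p.length := by
  generalize hz : YokeSeq.zero hQ m hn = z at p
  induction p with
  | nil =>
    refine ⟨0, ?_⟩
    subst hz
    simp [pathWeight, YokeSeq.path, YokeSeq.zero]
  | @cons u v w huv p ih =>
    obtain ⟨k, hk⟩ := ih hz
    obtain ⟨l, i, hi⟩ := YokeSeq.exists_path_of_adj huv
    refine ⟨k - l, ?_⟩
    have : pathWeight m u.path (n * (k - l)) ≤ pathWeight m v.path (n * k) + 1 := by
      have : pathWeight m u.path (n * (k - l)) ≤ ∑ j ∈ Finset.range (m + 1),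
          (|v.path j - n * k| + if j = i then 1 else 0) := by
        refine Finset.sum_le_sum fun j hj => ?_
        have a := hi j (by rw [Finset.mem_range] at hj; omega)
        have b := abs_sub_le (u.path j + n * l) (v.path j) (n * k)
        rw [abs_sub_comm (u.path j + n * l) (v.path j)] at b
        rw [show u.path j - n * (k - l) = u.path j + n * l - n * k by ring]
        linarith
      refine this.trans ?_
      rw [Finset.sum_add_distrib, Finset.sum_ite_eq', pathWeight]
      gcongr
      split_ifs <;> simp
    rw [SimpleGraph.Walk.length_cons]
    push_cast
    linarith

theorem YokeSeq.ofPath_congr_add_mul (hn : 1 ≤ n) {h g : ℕ → ℤ} (hh : ∀ i < m, h (i + 1) - h i ∈ Q)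
    (hg : ∀ i < m, g (i + 1) - g i ∈ Q) (k : ℤ) (e : ∀ i ≤ m, g i = h i + n * k) :
    YokeSeq.ofPath hn g hg = YokeSeq.ofPath hn h hh := by
  ext j
  rcases eq_or_ne j 0 with rfl | h0
  · rw [ofPath_entry_zero, ofPath_entry_zero, e 0 (by omega), Int.add_mul_emod_self_left]
  rcases eq_or_ne j (Fin.last (m + 1)) with rfl | h1
  · rw [ofPath_entry_last, ofPath_entry_last, e m le_rfl,
      show -(h m + n * k) = -h m + n * (-k) by ring, Int.add_mul_emod_self_left]
  · have b : (j : ℕ) ≠ m + 1 := fun e => h1 (Fin.ext e)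
    rw [ofPath_entry_inner _ _ _ h0 h1, ofPath_entry_inner _ _ _ h0 h1, e _ (by omega),
      e _ (by omega)]
    ring

theorem YokeSeq.adj_ofPath_of_add_one (hn : 1 ≤ n) {h g : ℕ → ℤ}
    (hh : ∀ i < m, h (i + 1) - h i ∈ Q) (hg : ∀ i < m, g (i + 1) - g i ∈ Q) {i : ℕ} (hi : i ≤ m)
    (e : ∀ j, g j = h j + if j = i then 1 else 0)
    (hne : YokeSeq.ofPath hn g hg ≠ YokeSeq.ofPath hn h hh) :
    (yokeTypeGraph Q n m).Adj (YokeSeq.ofPath hn g hg) (YokeSeq.ofPath hn h hh) := by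
  refine ⟨hne, ⟨i, by omega⟩, ?_, Or.inl ⟨?_, ?_⟩⟩
  · intro j h0 h1
    have h0' : (j : ℕ) ≠ i := fun e => h0 (Fin.ext e)
    have h1' : (j : ℕ) ≠ i + 1 := fun e => h1 (Fin.ext e)
    rcases eq_or_ne j 0 with rfl | c0
    · rw [ofPath_entry_zero, ofPath_entry_zero, e,
        if_neg (by simpa using h0'), add_zero]
    have c0' : (j : ℕ) ≠ 0 := fun e => c0 (Fin.ext e)
    rcases eq_or_ne j (Fin.last (m + 1)) with rfl | c1
    · rw [ofPath_entry_last, ofPath_entry_last, e, if_neg (by simp at h1'; omega), add_zero]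
    · rw [ofPath_entry_inner _ _ _ c0 c1, ofPath_entry_inner _ _ _ c0 c1, e, e, if_neg h0',
        if_neg (by omega), add_zero, add_zero]
  · rw [YokeEntryEq]
    have c1 : (⟨i, by omega⟩ : Fin (m + 1)).castSucc ≠ Fin.last (m + 1) := by
      intro e
      have := congrArg Fin.val e
      simp at this; omega
    rcases eq_or_ne (⟨i, by omega⟩ : Fin (m + 1)).castSucc 0 with c0 | c0
    · have : i = 0 := congrArg Fin.val c0
      rw [if_pos (Or.inl c0), c0, ofPath_entry_zero, ofPath_entry_zero, e, if_pos this.symm]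
      exact (Int.mod_modEq _ _).trans ((Int.mod_modEq _ _).symm.add_right 1)
    · have : i ≠ 0 := fun h => c0 (Fin.ext h)
      rw [if_neg (by tauto), ofPath_entry_inner _ _ _ c0 c1, ofPath_entry_inner _ _ _ c0 c1, e, e]
      simp only [Fin.val_castSucc, if_true]
      rw [if_neg (by omega)]
      ring
  · rw [YokeEntryEq]
    have c0 : (⟨i, by omega⟩ : Fin (m + 1)).succ ≠ 0 := Fin.succ_ne_zero _
    rcases eq_or_ne (⟨i, by omega⟩ : Fin (m + 1)).succ (Fin.last (m + 1)) with c1 | c1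
    · have : i = m := by simpa using congrArg Fin.val c1
      rw [if_pos (Or.inr c1), c1, ofPath_entry_last, ofPath_entry_last, e, if_pos this.symm,
        neg_add]
      exact (Int.mod_modEq _ _).trans ((Int.mod_modEq _ _).symm.add_right (-1))
    · rw [if_neg (by tauto), ofPath_entry_inner _ _ _ c0 c1, ofPath_entry_inner _ _ _ c0 c1, e, e]
      simp only [Fin.val_succ, Nat.add_sub_cancel, if_true]
      rw [if_neg (by omega)]
      ring

theorem YokeSeq.edist_ofPath_le_one (hn : 1 ≤ n) {h g : ℕ → ℤ}
    (hh : ∀ i < m, h (i + 1) - h i ∈ Q) (hg : ∀ i < m, g (i + 1) - g i ∈ Q) {i : ℕ} (hi : i ≤ m)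
    (e : ∀ j, g j = h j + if j = i then 1 else 0) :
    (yokeTypeGraph Q n m).edist (YokeSeq.ofPath hn g hg) (YokeSeq.ofPath hn h hh) ≤ 1 := by
  by_cases hne : YokeSeq.ofPath hn g hg = YokeSeq.ofPath hn h hh
  · simp [hne]
  · exact (SimpleGraph.edist_eq_one_iff_adj.2 (adj_ofPath_of_add_one hn hh hg hi e hne)).le

/-- A nonconstant path can be moved one step towards a constant one. -/
theorem exists_path_step_toward (hQ0 : 0 ∈ Q) (hQ1 : 1 ∈ Q) (hQ : ∀ x ∈ Q, |x| ≤ 1) {h : ℕ → ℤ}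
    (hh : ∀ i < m, h (i + 1) - h i ∈ Q) {c : ℤ} (hc : ∃ i ≤ m, h i ≠ c) :
    ∃ g : ℕ → ℤ, (∀ i < m, g (i + 1) - g i ∈ Q) ∧ pathWeight m g c + 1 = pathWeight m h c ∧
      ∃ i ≤ m, (∀ j, g j = h j + if j = i then 1 else 0) ∨
        (∀ j, h j = g j + if j = i then 1 else 0) := by
  have hQ' : ∀ x : ℤ, 0 ≤ x → x ≤ 1 → x ∈ Q := by
    intro x h0 h1
    obtain rfl | rfl : x = 0 ∨ x = 1 := by omega
    exacts [hQ0, hQ1]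
  have weight : ∀ (g : ℕ → ℤ) (i : ℕ), i ≤ m → (∀ j, j ≠ i → g j = h j) →
      |g i - c| + 1 = |h i - c| → pathWeight m g c + 1 = pathWeight m h c := by
    intro g i hi hj hw
    have hm : i ∈ Finset.range (m + 1) := by rw [Finset.mem_range]; omega
    rw [pathWeight, pathWeight, ← Finset.add_sum_erase _ _ hm, ← Finset.add_sum_erase _ _ hm,
      ← hw, Finset.sum_congr rfl (g := fun j => |h j - c|)]
    · ring
    · intro j hj'
      rw [hj j (Finset.ne_of_mem_erase hj')]
  by_cases hpos : ∃ i ≤ m, c < h i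
  · -- lower the first maximum
    obtain ⟨i₁, hi₁, hc₁⟩ := hpos
    have hex : ∃ i, i ≤ m ∧ ∀ j ≤ m, h j ≤ h i := by
      obtain ⟨i, hi, hmax⟩ := Finset.exists_max_image (Finset.range (m + 1)) h ⟨0, by simp⟩
      simp only [Finset.mem_range, Nat.lt_succ_iff] at hi hmax
      exact ⟨i, hi, hmax⟩
    classical
    obtain ⟨him, hmax⟩ := Nat.find_spec hex
    have hmin : ∀ j < Nat.find hex, h j < h (Nat.find hex) := by
      intro j hj
      have := Nat.find_min hex hj
      by_contra! hle
      exact this ⟨by omega, fun l hl => (hmax l hl).trans hle⟩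
    set i := Nat.find hex
    -- The step into the first maximum is `1` and becomes `0`; the step out is `0` or `-1` and
    -- becomes `1` or `0`. So the new steps lie in `Q` even when `-1` does not.
    refine ⟨fun j => h j - if j = i then 1 else 0, ?_, ?_, i, him, Or.inr fun j => by simp⟩
    · intro j hj
      have a := hh j hj
      have b := abs_le.1 (hQ _ a)
      dsimp only
      by_cases c1 : j + 1 = i
      · have := hmin j (by omega)
        rw [if_pos c1, if_neg (by omega)]
        rw [← c1] at this
        exact hQ' _ (by omega) (by omega)
      by_cases c2 : j = i
      · have := hmax (j + 1) (by omega)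
        rw [if_neg c1, if_pos c2]
        rw [← c2] at this
        exact hQ' _ (by omega) (by omega)
      · rwa [if_neg c1, if_neg c2, sub_zero, sub_zero]
    · refine weight _ i him (fun j hj => by simp [hj]) ?_
      have := hmax i₁ hi₁
      simp only [if_true]
      rw [abs_of_nonneg (by omega), abs_of_nonneg (by omega)]
      ring
  · -- raise the last minimum
    push Not at hpos
    obtain ⟨i₁, hi₁, hc₁⟩ := hc
    have hc₁ : h i₁ < c := lt_of_le_of_ne (hpos i₁ hi₁) hc₁
    -- Indexing from the right end lets `Nat.find` select the last minimum.
    have hex : ∃ i, i ≤ m ∧ ∀ j ≤ m, h (m - i) ≤ h j := by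
      obtain ⟨i, hi, hmax⟩ := Finset.exists_min_image (Finset.range (m + 1)) h ⟨0, by simp⟩
      simp only [Finset.mem_range, Nat.lt_succ_iff] at hi hmax
      exact ⟨m - i, by omega, by rwa [show m - (m - i) = i by omega]⟩
    classical
    obtain ⟨him, hmax⟩ := Nat.find_spec hex
    have hmin : ∀ j ≤ m, m - Nat.find hex < j → h (m - Nat.find hex) < h j := by
      intro j hj hlt
      have := Nat.find_min hex (m := m - j) (by omega)
      by_contra! hle
      refine this ⟨by omega, fun l hl => ?_⟩
      rw [show m - (m - j) = j by omega]
      exact hle.trans (hmax l hl)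
    set i := m - Nat.find hex
    have him' : i ≤ m := Nat.sub_le _ _
    refine ⟨fun j => h j + if j = i then 1 else 0, ?_, ?_, i, him', Or.inl fun j => rfl⟩
    · intro j hj
      have a := hh j hj
      have b := abs_le.1 (hQ _ a)
      dsimp only
      by_cases c1 : j + 1 = i
      · have := hmax j (by omega)
        rw [if_pos c1, if_neg (by omega)]
        rw [← c1] at this
        exact hQ' _ (by omega) (by omega)
      by_cases c2 : j = i
      · have := hmin (j + 1) (by omega) (by omega)
        rw [if_neg c1, if_pos c2]
        rw [← c2] at this
        exact hQ' _ (by omega) (by omega)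
      · rwa [if_neg c1, if_neg c2, add_zero, add_zero]
    · refine weight _ i him' (fun j hj => by simp [hj]) ?_
      have := hmax i₁ hi₁
      simp only [if_true]
      rw [abs_of_nonpos (by omega), abs_of_nonpos (by omega)]
      ring

theorem YokeSeq.ofPath_eq_zero (hQ0 : 0 ∈ Q) (hn : 1 ≤ n) {h : ℕ → ℤ}
    (hh : ∀ i < m, h (i + 1) - h i ∈ Q) {k : ℤ} (hc : ∀ i ≤ m, h i = n * k) :
    YokeSeq.ofPath hn h hh = YokeSeq.zero hQ0 m hn := by
  rw [ofPath_congr_add_mul (h := fun _ => 0) (k := k) hn (by simpa using fun _ _ => hQ0) hh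
    (by simpa using hc)]
  ext j
  simp [YokeSeq.ofPath, YokeSeq.zero]

theorem YokeSeq.edist_zero_ofPath_le (hQ0 : 0 ∈ Q) (hQ1 : 1 ∈ Q) (hQ : ∀ x ∈ Q, |x| ≤ 1)
    (hn : 1 ≤ n) (k : ℤ) {h : ℕ → ℤ} (hh : ∀ i < m, h (i + 1) - h i ∈ Q) (w : ℕ)
    (hw : pathWeight m h (n * k) = w) :
    (yokeTypeGraph Q n m).edist (YokeSeq.zero hQ0 m hn) (YokeSeq.ofPath hn h hh) ≤ w := by
  induction w generalizing h with
  | zero =>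
    rw [ofPath_eq_zero hQ0 hn hh (k := k)]
    · simp
    · intro i hi
      have := (Finset.sum_eq_zero_iff_of_nonneg (fun i _ => abs_nonneg (h i - n * k))).1 hw i
        (by rw [Finset.mem_range]; omega)
      rw [abs_eq_zero] at this
      linarith
  | succ w ih =>
    by_cases hc : ∃ i ≤ m, h i ≠ n * k
    · obtain ⟨g, hg, hgw, i, hi, hgh⟩ := exists_path_step_toward hQ0 hQ1 hQ hh hc
      have d1 := ih hg (by push_cast at hw; linarith)
      have d2 : (yokeTypeGraph Q n m).edist
          (YokeSeq.ofPath hn g hg) (YokeSeq.ofPath hn h hh) ≤ 1 := by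
        rcases hgh with e | e
        · exact edist_ofPath_le_one hn hh hg hi e
        · rw [SimpleGraph.edist_comm]
          exact edist_ofPath_le_one hn hg hh hi e
      push_cast
      exact SimpleGraph.edist_triangle.trans (add_le_add d1 d2)
    · push Not at hc
      rw [ofPath_eq_zero hQ0 hn hh hc]
      simp

theorem YokeSeq.eccent_zero_eq {B : ℕ} (hQ0 : 0 ∈ Q) (hQ1 : 1 ∈ Q) (hQ : ∀ x ∈ Q, |x| ≤ 1)
    (hn : 1 ≤ n) (hB : IsPathRadius n m B) :
    (yokeTypeGraph Q n m).eccent (YokeSeq.zero hQ0 m hn) = B := by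
  apply le_antisymm
  · refine iSup_le fun v => ?_
    obtain ⟨k, hk⟩ := hB.le v.path fun i hi => hQ _ (v.path_step_mem i hi)
    have h0 : 0 ≤ pathWeight m v.path (n * k) := Finset.sum_nonneg fun _ _ => abs_nonneg _
    obtain ⟨w, hw⟩ := Int.eq_ofNat_of_zero_le h0
    have := edist_zero_ofPath_le hQ0 hQ1 hQ hn k v.path_step_mem w hw
    rw [ofPath_path] at this
    refine this.trans ?_
    rw [hw] at hk
    exact_mod_cast hk
  · obtain ⟨h, hh, hw⟩ := hB.ge
    have hhQ : ∀ i < m, h (i + 1) - h i ∈ Q := by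
      intro i hi
      rcases hh i hi with e | e <;> rw [e] <;> assumption
    refine le_trans ?_ (SimpleGraph.edist_le_eccent (v := YokeSeq.ofPath hn h hhQ))
    rw [SimpleGraph.edist_comm]
    refine le_iInf fun p => ?_
    obtain ⟨k, hk⟩ := exists_pathWeight_le_length hQ0 hn p
    obtain ⟨l, hl⟩ : ∃ l : ℤ, ∀ i ≤ m, (YokeSeq.ofPath hn h hhQ).path i = h i + n * l := by
      -- `YokeSeq.ofPath` reduces `h 0` modulo `n`, which translates the whole path by this
      -- multiple.
      refine ⟨-(h 0 / n), fun i => ?_⟩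
      induction i with
      | zero =>
        intro _
        rw [path_zero, ofPath_entry_zero, Int.emod_def]; ring
      | succ i ih =>
        intro hi
        rw [path_succ _ (by omega), ih (by omega), ofPath_entry_inner]
        · simp only [Nat.add_sub_cancel]; ring
        · intro e; simpa using congrArg Fin.val e
        · intro e
          have := congrArg Fin.val e
          simp at this; omega
    have e : pathWeight m (YokeSeq.ofPath hn h hhQ).path (n * k) = pathWeight m h (n * (k - l)) :=
      Finset.sum_congr rfl fun i hi => by
        rw [hl i (by rw [Finset.mem_range] at hi; omega)]
        congr 1; ring
    have := hw (k - l)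
    rw [← e] at this
    exact_mod_cast this.trans hk

theorem dYokeGraph_eccent_eq {B : ℕ} (hn : 1 ≤ n) (hB : IsPathRadius n m B) :
    (dYokeGraph n m).eccent (dYokeZero m hn) = B :=
  YokeSeq.eccent_zero_eq _ (by simp) (by simp) hn hB

theorem yokeGraph_eccent_eq {B : ℕ} (hn : 1 ≤ n) (hB : IsPathRadius n m B) :
    (yokeGraph n m).eccent (yokeZero m hn) = B :=
  YokeSeq.eccent_zero_eq _ (by simp) (by simp) hn hB

/-! ### Matching the binomial formulas -/

theorem two_mul_choose_succ_two (x : ℕ) : 2 * (x + 1).choose 2 = x * (x + 1) := by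
  induction x with
  | zero => rfl
  | succ x ih => rw [Nat.choose_succ_succ', mul_add, ih, Nat.choose_one_right]; ring

theorem two_mul_yokeD0_even (n b : ℕ) :
    2 * yokeD0 n (n + 2 * b) = n * (n + 2 * b + 1) + 2 * b * (b + 1) := by
  rw [yokeD0, Nat.ceilDiv_eq_add_pred_div, show (n + 2 * b + n) / 2 = n + b by omega,
    show (n + 2 * b - n + 2 - 1) / 2 = b by omega, mul_add, two_mul_choose_succ_two,
    two_mul_choose_succ_two]
  ring

theorem two_mul_yokeD0_odd (n b : ℕ) :
    2 * yokeD0 n (n + 1 + 2 * b) = n * (n + 1 + 2 * b) + 2 * (b + 1) ^ 2 := by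
  rw [yokeD0, Nat.ceilDiv_eq_add_pred_div, show (n + 1 + 2 * b + n) / 2 = n + b by omega,
    show (n + 1 + 2 * b - n + 2 - 1) / 2 = b + 1 by omega, mul_add, two_mul_choose_succ_two,
    two_mul_choose_succ_two]
  ring

theorem isPathRadius_yokeD0 (hn : 1 ≤ n) (hnm : n ≤ m)
    (h : 2 ∣ m - n ∨ n ≤ (m + 1) ⌈/⌉ 2) : IsPathRadius n m (yokeD0 n m) := by
  rw [Nat.ceilDiv_eq_add_pred_div] at h
  rcases Nat.even_or_odd' (m - n) with ⟨b, hb | hb⟩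
  · obtain rfl : m = n + 2 * b := by omega
    exact isPathRadius_of_even hn (two_mul_yokeD0_even n b)
  · obtain rfl : m = n + 1 + 2 * b := by omega
    exact isPathRadius_of_odd_of_le hn (two_mul_yokeD0_odd n b) (by omega)

theorem isPathRadius_yokeD0_add (hn : 1 ≤ n) (hnm : n ≤ m)
    (h : ¬ (2 ∣ m - n ∨ n ≤ (m + 1) ⌈/⌉ 2)) :
    IsPathRadius n m (yokeD0 n m + (n - (m + 1) ⌈/⌉ 2)) := by
  rw [Nat.ceilDiv_eq_add_pred_div] at *
  obtain ⟨b, hb⟩ : Odd (m - n) := by rw [← Nat.not_even_iff_odd, even_iff_two_dvd]; tauto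
  obtain rfl : m = n + 1 + 2 * b := by omega
  refine isPathRadius_of_odd_of_ge hn ?_ (by omega)
  have e := two_mul_yokeD0_odd n b
  -- The averaging bound is twice `yokeD0` plus `n - (2 * b + 2)`; halving and rounding down yields
  -- the correction term.
  have e2 : n * (n + 2 * b + 2) + 2 * b * (b + 1) + (2 * b + 2) =
    n * (n + 1 + 2 * b) + 2 * (b + 1) ^ 2 + n := by ring
  omega

theorem yokeD0_one (hm : 1 ≤ m) :
    yokeD0 1 m = Nat.choose (m ⌈/⌉ 2 + 1) 2 + Nat.choose (m / 2 + 1) 2 := by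
  rw [yokeD0, Nat.ceilDiv_eq_add_pred_div, Nat.ceilDiv_eq_add_pred_div,
    show (m - 1 + 2 - 1) / 2 = m / 2 by omega, show (m + 2 - 1) / 2 = (m + 1) / 2 by omega]

theorem exists_isPathRadius (hn : 1 ≤ n) (m : ℕ) : ∃ B, IsPathRadius n m B := by
  rcases le_total m n with hmn | hmn
  · exact ⟨_, isPathRadius_of_le hn hmn⟩
  by_cases h : 2 ∣ m - n ∨ n ≤ (m + 1) ⌈/⌉ 2
  · exact ⟨_, isPathRadius_yokeD0 hn hmn h⟩
  · exact ⟨_, isPathRadius_yokeD0_add hn hmn h⟩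

end

theorem mainTheorem4 (n m : ℕ) (hn : 1 ≤ n) :
    (dYokeGraph n m).eccent (dYokeZero m hn) = (yokeGraph n m).eccent (yokeZero m hn) ∧
    (n = 1 → (dYokeGraph n m).eccent (dYokeZero m hn) =
      ((Nat.choose (m ⌈/⌉ 2 + 1) 2 + Nat.choose (m / 2 + 1) 2 : ℕ) : ℕ∞)) ∧
    (m ≤ n → (dYokeGraph n m).eccent (dYokeZero m hn) = ((n * (m + 1) / 2 : ℕ) : ℕ∞)) ∧
    (2 ≤ n → n ≤ m →
      ((2 ∣ m - n ∨ n ≤ (m + 1) ⌈/⌉ 2) →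
        (dYokeGraph n m).eccent (dYokeZero m hn) = ((yokeD0 n m : ℕ) : ℕ∞)) ∧
      (¬ (2 ∣ m - n ∨ n ≤ (m + 1) ⌈/⌉ 2) →
        (dYokeGraph n m).eccent (dYokeZero m hn) =
          ((yokeD0 n m + (n - (m + 1) ⌈/⌉ 2) : ℕ) : ℕ∞))) := by
  refine ⟨?_, ?_, fun hmn => dYokeGraph_eccent_eq hn (isPathRadius_of_le hn hmn), fun _ hnm =>
    ⟨fun h => dYokeGraph_eccent_eq hn (isPathRadius_yokeD0 hn hnm h),
      fun h => dYokeGraph_eccent_eq hn (isPathRadius_yokeD0_add hn hnm h)⟩⟩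
  · obtain ⟨B, hB⟩ := exists_isPathRadius hn m
    rw [dYokeGraph_eccent_eq hn hB, yokeGraph_eccent_eq hn hB]
  · rintro rfl
    -- `yokeD0 1 m` is meaningful only for `1 ≤ m`, so `m = 0` is taken from the case `m ≤ n`.
    rcases Nat.eq_zero_or_pos m with rfl | hm
    · rw [dYokeGraph_eccent_eq hn (isPathRadius_of_le hn (Nat.zero_le 1))]
      rfl
    · rw [← yokeD0_one hm]
      refine dYokeGraph_eccent_eq hn (isPathRadius_yokeD0 hn hm (Or.inr ?_))
      rw [Nat.ceilDiv_eq_add_pred_div]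
      omega
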